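/- \textbf{Setting.} A directive sequence $\boldsymbol\tau=(\tau_n:\mathcal A_{n+1}^*\to\mathcal A_n^*)_{n\ge 0}$ is a sequence of nonerasing morphisms between free monoids over finite alphabets. Put $\tau_{[n,N)}=\tau_n\circ\cdots\circ\tau_{N-1}$ for $n<N$, let $\tau_{[n,n)}$ be the identity, and let $|\tau_{[0,n)}|$ and $\langle\tau_{[0,n)}\rangle$ be the maximum and the minimum of the lengths $|\tau_{[0,n)}(a)|$, $a\in\mathcal A_n$. Let $X^{(n)}_{\boldsymbol\tau}$ be the set of $x\in\mathcal A_n^{\mathbb Z}$ all of whose finite subwords occur in words $\tau_{[n,N)}(a)$ with $N>n$, $a\in\mathcal A_N$; put $X_{\boldsymbol\tau}=X^{(0)}_{\boldsymbol\tau}$, let $S$ be the shift map and write $[a]=\{x\in X^{(n)}_{\boldsymbol\tau}:x_0=a\}$ for $a\in\mathcal A_n$. A nonerasing morphism acts on two-sided sequences by concatenation, the image of the letter $x_0$ starting at coordinate $0$. The sequence $\boldsymbol\tau$ is \emph{primitive} if for each $n$ there is $N>n$ such that every $\tau_{[n,N)}(a)$, $a\in\mathcal A_N$, contains all letters of $\mathcal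 A_n$; \emph{proper} if for each $n$ there are letters $p,s\in\mathcal A_n$ such that every $\tau_n(a)$, $a\in\mathcal A_{n+1}$, starts with $p$ and ends with $s$; and \emph{recognizable} if for each $n$ every $y\in\mathcal A_n^{\mathbb Z}$ can be written in at most one way as $y=S^k\tau_n(x)$ with $x\in X^{(n+1)}_{\boldsymbol\tau}$ and $0\le k<|\tau_n(x_0)|$. Put $h_n(a)=|\tau_{[0,n)}(a)|$ and $\mathcal T_n(a)=\bigcup_{0\le k<h_n(a)}S^k\tau_{[0,n)}([a])$ for $a\in\mathcal A_n$. For an ergodic $S$-invariant Borel probability measure $\mu$ on $X_{\boldsymbol\tau}$, the sequence $\boldsymbol\tau$ is \emph{clean with respect to $\mu$}, with set of letters $\mathcal A_\mu$, if there are $n_0\in\mathbb N$ and $c>0$ such that $\mathcal A_n=\mathcal A_{n_0}=:\mathcal A$ for all $n\ge n_0$, $\mathcal A_\mu\subseteq\mathcal A$, $\mu(\mathcal T_n(a))\ge c$ for all $n\ge n_0$ and $a\in\mathcal A_\mu$, and $\lim_{n\to\infty}\mu(\mathcal T_n(a))=0$ for all $a\in\mathcal A\setminus\mathcal A_\mu$.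 \textbf{Proposition (Veech criterion for $\mathcal S$-adic subshifts).} Let $\boldsymbol\tau$ be a primitive, proper and recognizable directive sequence, let $\mu$ be an ergodic invariant Borel probability measure of $(X_{\boldsymbol\tau},S)$, and let $\boldsymbol\tau$ be clean with respect to $\mu$, with set of letters $\mathcal A_\mu$. Suppose that (i) there is $K>0$ such that $|\tau_{[0,n)}|/\langle\tau_{[0,n)}\rangle\le K$ for all large enough $n$; and (ii) there are $\delta>0$ and, for all large enough $n$, a nonempty word $u_n\in\mathcal A_0^*$ and indices $0\le c_n<d_n\le\min_{a\in\mathcal A_\mu}|\tau_{[0,n)}(a)|$ such that $|u_n|\ge\delta\min_{a\in\mathcal A_\mu}|\tau_{[0,n)}(a)|$ and, for every $a\in\mathcal A_\mu$, the subword of $\tau_{[0,n)}(a)$ at the positions $c_n,c_n+1,\dots,d_n-1$ (counted from $0$) is $u_n$. Let $\alpha\in\mathbb R$ be such that $\exp(2\pi i\alpha)$ is a measurable eigenvalue of $(X_{\boldsymbol\tau},S)$ with respect to $\mu$, that is, there is a nonzero $f\in L^2(X_{\boldsymbol\tau},\mu)$ with $f\circ S=\exp(2\pi i\alpha)f$.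 Then $$\lim_{n\to\infty}|||\alpha h_n(a)|||=0\qquad\text{for every }a\in\mathcal A_\mu,$$ where $|||x|||=\inf_{m\in\mathbb Z}|x-m|$. -/

import Mathlib

open Filter Topology MeasureTheory

namespace SAdic

/-! Words over a set of letters `L` are lists, points are maps `ℤ → L`. A morphism of free monoids
is given by the images `σ : L → List L` of the letters, and `w.flatMap σ` is the image of a word. -/

/-- The word `x_n x_{n+1} ⋯ x_{n+ℓ-1}`. -/
def window {L : Type*} (x : ℤ → L) (n : ℤ) (l : ℕ) : List L :=
  (List.range l).map fun i => x (n + (i : ℤ))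

/-- The shift map `(x_n) ↦ (x_{n+1})`. -/
def shift {L : Type*} (x : ℤ → L) : ℤ → L := fun n => x (n + 1)

/-- The extension of a morphism to two-sided sequences: the words `σ (x_0) σ (x_1) ⋯` fill the
coordinates `0, 1, …` and the words `⋯ σ (x_{-2}) σ (x_{-1})` fill the coordinates `…, -2, -1`.
When no `σ (x_i)` is empty, the first `i + 1` words on the relevant side reach the `i`-th
coordinate on that side, so that the default value `x 0` is never used. -/
def extend {L : Type*} (σ : L → List L) (x : ℤ → L) : ℤ → L
  | Int.ofNat i => ((window x 0 (i + 1)).flatMap σ).getD i (x 0)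
  | Int.negSucc j =>
      let w := (window x (Int.negSucc j) (j + 1)).flatMap σ
      w.getD (w.length - (j + 1)) (x 0)

/-- `|σ|`, the maximal length of the words `σ a`, `a ∈ A`. -/
noncomputable def maxLength {L : Type*} (A : Finset L) (σ : L → List L) : ℕ :=
  ⨆ a : A, (σ a).length

/-- `⟨σ⟩`, the minimal length of the words `σ a`, `a ∈ A`. -/
noncomputable def minLength {L : Type*} (A : Finset L) (σ : L → List L) : ℕ :=
  ⨅ a : A, (σ a).length

/-- `σ` is recognizable in `X`: every point `y` has at most one representation `y = S^k σ(x)` with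
`x ∈ X` and `0 ≤ k < |σ(x_0)|`. -/
def RecognizableIn {L : Type*} (σ : L → List L) (X : Set (ℤ → L)) : Prop :=
  ∀ y : ℤ → L, ∀ x ∈ X, ∀ x' ∈ X, ∀ k k' : ℕ,
    k < (σ (x 0)).length → k' < (σ (x' 0)).length →
    y = shift^[k] (extend σ x) → y = shift^[k'] (extend σ x') → k = k' ∧ x = x'

/-- A directive sequence of nonerasing morphisms `τ_n : A_{n+1}^* → A_n^*`, where all the alphabets
`A_n` are finite subsets of `L`. The value of `τ_n` at letters outside `A_{n+1}` is irrelevant. -/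
structure DirectiveSequence (L : Type*) where
  alphabet : ℕ → Finset L
  map : ℕ → L → List L
  map_mem : ∀ n, ∀ a ∈ alphabet (n + 1), ∀ b ∈ map n a, b ∈ alphabet n
  nonerasing : ∀ n, ∀ a ∈ alphabet (n + 1), map n a ≠ []

namespace DirectiveSequence

variable {L : Type*}

/-- The morphism `τ_{[n,n+k)} = τ_n ∘ τ_{n+1} ∘ ⋯ ∘ τ_{n+k-1}`, on letters. -/
def block (τ : DirectiveSequence L) (n : ℕ) : ℕ → L → List L
  | 0 => fun a => [a]
  | k + 1 => fun a => (τ.map (n + k) a).flatMap (block τ n k)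

/-- Every morphism is proper: there are letters `p`, `s` such that all images of letters start
with `p` and end with `s`. -/
def IsProper (τ : DirectiveSequence L) : Prop :=
  ∀ n, ∃ p ∈ τ.alphabet n, ∃ s ∈ τ.alphabet n, ∀ a ∈ τ.alphabet (n + 1),
    (τ.map n a).head? = some p ∧ (τ.map n a).getLast? = some s

/-- For every `n` there is `N = n + k > n` such that all letters of `A_n` occur in every word
`τ_{[n,N)}(a)`, `a ∈ A_N`. -/
def IsPrimitive (τ : DirectiveSequence L) : Prop :=
  ∀ n, ∃ k, 0 < k ∧ ∀ a ∈ τ.alphabet (n + k), ∀ b ∈ τ.alphabet n, b ∈ τ.block n k a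

/-- The language of level `n`: the words occurring in some `τ_{[n,N)}(a)`, `N > n`, `a ∈ A_N`. -/
def language (τ : DirectiveSequence L) (n : ℕ) : Set (List L) :=
  {w | ∃ k, 0 < k ∧ ∃ a ∈ τ.alphabet (n + k), w <:+: τ.block n k a}

/-- The subshift `X^{(n)}` generated by the language of level `n`. -/
def levelSubshift (τ : DirectiveSequence L) (n : ℕ) : Set (ℤ → L) :=
  {x | ∀ (m : ℤ) (l : ℕ), window x m l ∈ τ.language n}

/-- The `S`-adic subshift `X_τ = X^{(0)}`, as a subspace of `ℤ → L`. -/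
abbrev Subshift (τ : DirectiveSequence L) : Type _ := τ.levelSubshift 0

/-- `τ_n` is recognizable in `X^{(n+1)}` for every `n`. -/
def IsRecognizable (τ : DirectiveSequence L) : Prop :=
  ∀ n, RecognizableIn (τ.map n) (τ.levelSubshift (n + 1))

theorem shift_mem (τ : DirectiveSequence L) (n : ℕ) {x : ℤ → L} (hx : x ∈ τ.levelSubshift n) :
    shift x ∈ τ.levelSubshift n := by
  intro m l
  have h : window (shift x) m l = window x (m + 1) l := by
    unfold window shift
    refine List.map_congr_left fun i _ => ?_
    congr 1
    ring
  rw [h]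
  exact hx _ _

/-- The shift map `S : X_τ → X_τ`. -/
def S (τ : DirectiveSequence L) (x : τ.Subshift) : τ.Subshift :=
  ⟨shift x.1, τ.shift_mem 0 x.2⟩

/-- The height `h_n(a) = |τ_{[0,n)}(a)|`. -/
def height (τ : DirectiveSequence L) (n : ℕ) (a : L) : ℕ := (τ.block 0 n a).length

/-- The base `B_n(a) = τ_{[0,n)}([a])`, where `[a] = {x ∈ X^{(n)} : x_0 = a}`. -/
def base (τ : DirectiveSequence L) (n : ℕ) (a : L) : Set τ.Subshift :=
  {y | ∃ x ∈ τ.levelSubshift n, x 0 = a ∧ (y : ℤ → L) = extend (τ.block 0 n) x}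

/-- The tower `T_n(a)`, the union of the levels `S^k B_n(a)` for `0 ≤ k < h_n(a)`. -/
def tower (τ : DirectiveSequence L) (n : ℕ) (a : L) : Set τ.Subshift :=
  ⋃ k ∈ Set.Iio (τ.height n a), τ.S^[k] '' τ.base n a

/-- `τ` is clean with respect to `μ`, with `Aμ` as set of letters whose towers keep a mass bounded
below, whereas the mass of the towers of the other letters tends to `0`. -/
def IsCleanWith (τ : DirectiveSequence L) [MeasurableSpace τ.Subshift] (μ : Measure τ.Subshift)
    (Aμ : Finset L) : Prop :=
  ∃ n₀ : ℕ, (∀ n ≥ n₀, τ.alphabet n = τ.alphabet n₀) ∧ Aμ ⊆ τ.alphabet n₀ ∧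
    (∃ c : ℝ, 0 < c ∧ ∀ n ≥ n₀, ∀ a ∈ Aμ, c ≤ μ.real (τ.tower n a)) ∧
    ∀ a ∈ τ.alphabet n₀, a ∉ Aμ → Tendsto (fun n => μ.real (τ.tower n a)) atTop (𝓝 0)

end DirectiveSequence

/-- `z` is a measurable eigenvalue of `T` with respect to `μ`: there is a nonzero `f ∈ L²(μ)` with
`f ∘ T = z f`. -/
def IsMeasurableEigenvalue {X : Type*} [MeasurableSpace X] (T : X → X) (μ : Measure X) (z : ℂ) :
    Prop :=
  ∃ f : X → ℂ, MemLp f 2 μ ∧ ¬ f =ᵐ[μ] 0 ∧ f ∘ T =ᵐ[μ] fun x => z * f x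

/-- `|||x|||`, the distance from `x` to the nearest integer. -/
noncomputable def distInt (x : ℝ) : ℝ := ⨅ m : ℤ, |x - (m : ℝ)|

end SAdic

/-! Let `z = exp(2πiα)` and let `f` be an eigenfunction. By ergodicity `|f|` is almost surely a
constant `r > 0`. Choose a continuous `g` that is `L¹`-close to `f`; by compactness `g` depends, up
to `ε`, only on a central window of some radius `m`. Fix `a ∈ A_μ`, put `h = h_n(a)`, and let `D`
consist of the points `S^k y` with `c_n + m ≤ k < d_n - m`, where `y ∈ B_n(a)` and `S^h y` again
lies in the base of a letter of `A_μ`. Around `S^k y` and around `S^h S^k y` the window of radius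
`m` is read inside `u_n`, at the same place, so `g` is `ε`-invariant under `S^h` on `D`. Since `f ∘
S^h = z^h f`, this gives `r |z^h - 1| μ(D) ≤ 3ε` (`norm_pow_height_sub_one_mul_le`).

The mass of `D` stays away from `0`. By (i) and (ii), `u_n` fills a proportion at least `δ/K` of the
tower, and the loss of `2m` levels is harmless once the heights are large (`tendsto_height_atTop`).
The points of `B_n(a)` that return over a letter outside `A_μ` are negligible, because those towers
lose their mass and all heights are comparable (`le_measureReal_returnSet`). Hence `z^h → 1`, which
is converted to `|||αh||| → 0` by `four_mul_distInt_le`. If there is only one letter, heights need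
not grow, but then the base consists of periodic points and `z^h = 1` exactly. -/

namespace SAdic

/-! ### Words, windows and the action of morphisms on two-sided sequences. -/

section Words

variable {L : Type*}

theorem window_eq_map (x : ℤ → L) (n : ℤ) (l : ℕ) :
    window x n l = (List.range l).map fun i : ℕ => x (n + (i : ℤ)) := by
  refine List.ext_getElem (by simp [window]) fun i h₁ h₂ => ?_
  simp [window, ← List.map_eq_flatMap]

@[simp]
theorem length_window (x : ℤ → L) (n : ℤ) (l : ℕ) : (window x n l).length = l := by
  simp [window_eq_map]

@[simp]
theorem getElem_window (x : ℤ → L) (n : ℤ) (l i : ℕ) (h : i < (window x n l).length) :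
    (window x n l)[i] = x (n + i) := by
  simp [window_eq_map]

theorem window_add (x : ℤ → L) (n : ℤ) (k l : ℕ) :
    window x n (k + l) = window x n k ++ window x (n + k) l := by
  simp [window_eq_map, List.range_add, add_assoc, Function.comp_def]

@[simp]
theorem window_zero (x : ℤ → L) (n : ℤ) : window x n 0 = [] := rfl

@[simp]
theorem window_one (x : ℤ → L) (n : ℤ) : window x n 1 = [x n] := by
  simp [window_eq_map]

theorem mem_window {x : ℤ → L} {n : ℤ} {l : ℕ} {a : L} (h : a ∈ window x n l) :
    ∃ i, x i = a := by
  simp only [window_eq_map, List.mem_map] at h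
  obtain ⟨i, -, hi⟩ := h
  exact ⟨_, hi⟩

theorem iterate_shift_apply (x : ℤ → L) (k : ℕ) (i : ℤ) : shift^[k] x i = x (i + k) := by
  induction k generalizing x with
  | zero => simp
  | succ k ih =>
    rw [Function.iterate_succ_apply, ih]
    simp only [shift]
    congr 1
    push_cast
    ring

theorem window_iterate_shift (x : ℤ → L) (k : ℕ) (n : ℤ) (l : ℕ) :
    window (shift^[k] x) n l = window x (n + k) l := by
  refine List.ext_getElem (by simp) fun i h₁ h₂ => ?_
  rw [getElem_window, getElem_window, iterate_shift_apply]
  congr 1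
  ring

theorem window_shift (x : ℤ → L) (n : ℤ) (l : ℕ) :
    window (shift x) n l = window x (n + 1) l := by
  simpa using window_iterate_shift x 1 n l

theorem window_isInfix (x : ℤ → L) {m n : ℤ} {k l : ℕ} (h₁ : n ≤ m) (h₂ : m + k ≤ n + l) :
    window x m k <:+: window x n l := by
  obtain ⟨i, rfl⟩ := Int.le.dest h₁
  obtain ⟨j, hj⟩ : ∃ j : ℕ, l = i + k + j := ⟨l - (i + k), by omega⟩
  subst hj
  refine ⟨window x n i, window x (n + (i + k : ℕ)) j, ?_⟩
  rw [window_add, window_add]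

theorem length_le_length_flatMap {σ : L → List L} {w : List L} (h : ∀ a ∈ w, σ a ≠ []) :
    w.length ≤ (w.flatMap σ).length := by
  induction w with
  | nil => simp
  | cons a w ih =>
    have h₁ := List.length_pos_iff.2 (h a (by simp))
    have h₂ := ih fun b hb => h b (by simp [hb])
    simp only [List.length_cons, List.flatMap_cons, List.length_append]
    omega

/-- The point `y` is obtained from `x` by concatenating the words `σ (x i)`, with `σ (x 0)`
starting at coordinate `0`. -/
structure IsExtension (σ : L → List L) (x y : ℤ → L) : Prop where
  right : ∀ q : ℕ, window y 0 ((window x 0 q).flatMap σ).length = (window x 0 q).flatMap σ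
  left : ∀ p : ℕ, window y (-((window x (-p) p).flatMap σ).length)
    ((window x (-p) p).flatMap σ).length = (window x (-p) p).flatMap σ

/-- Images of windows starting at `0` are nested prefixes and images of windows ending just before
`0` are nested suffixes. As no letter is erased, `j + 1` letters already reach the required
coordinate, so the default value in `getD` is never read. -/
theorem isExtension_extend {σ : L → List L} {x : ℤ → L} (h : ∀ i, σ (x i) ≠ []) :
    IsExtension σ x (extend σ x) := by
  have hlen (n : ℤ) (l : ℕ) : l ≤ ((window x n l).flatMap σ).length := by
    refine (length_window x n l).symm.le.trans (length_le_length_flatMap fun a ha => ?_)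
    obtain ⟨i, rfl⟩ := mem_window ha
    exact h i
  constructor
  · have hpre {k l : ℕ} (hkl : k ≤ l) :
        (window x 0 k).flatMap σ <+: (window x 0 l).flatMap σ := by
      obtain ⟨j, rfl⟩ := Nat.exists_eq_add_of_le hkl
      rw [window_add, List.flatMap_append]
      exact List.prefix_append _ _
    intro q
    refine List.ext_getElem (by simp) fun j h₁ h₂ => ?_
    have hj : j < ((window x 0 (j + 1)).flatMap σ).length := hlen 0 (j + 1)
    rw [getElem_window, zero_add]
    change ((window x 0 (j + 1)).flatMap σ).getD j (x 0) = _
    rw [List.getD_eq_getElem _ _ hj]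
    rcases le_total q (j + 1) with hq | hq
    · exact ((hpre hq).getElem h₂).symm
    · exact (hpre hq).getElem hj
  · have hsuf {k l : ℕ} (hkl : k ≤ l) :
        (window x (-k) k).flatMap σ <:+ (window x (-l) l).flatMap σ := by
      obtain ⟨j, rfl⟩ := Nat.exists_eq_add_of_le' hkl
      rw [window_add, List.flatMap_append]
      have : -((j + k : ℕ) : ℤ) + j = -k := by push_cast; ring
      rw [this]
      exact List.suffix_append _ _
    -- On the negative side words are aligned at their right ends, so entries are compared by their
    -- distance from the end.
    have hget {v w : List L} (hvw : v <:+ w) {i : ℕ} (hi : i < v.length) :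
        v[v.length - (i + 1)] = w[w.length - (i + 1)]'(by
          have := hvw.length_le
          omega) := by
      obtain ⟨t, rfl⟩ := hvw
      rw [List.getElem_append_right (by simp; omega)]
      congr 1
      simp
      omega
    intro p
    refine List.ext_getElem (by simp) fun j h₁ h₂ => ?_
    rw [getElem_window]
    set w := (window x (-p) p).flatMap σ with hw
    obtain ⟨i, hi⟩ : ∃ i, w.length = j + (i + 1) := ⟨w.length - (j + 1), by omega⟩
    have hc : (-(w.length : ℤ) + j) = Int.negSucc i := by
      rw [hi, Int.negSucc_eq]
      push_cast
      ring
    rw [hc]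
    have hneg : Int.negSucc i = -((i + 1 : ℕ) : ℤ) := rfl
    change ((window x (Int.negSucc i) (i + 1)).flatMap σ).getD
      (((window x (Int.negSucc i) (i + 1)).flatMap σ).length - (i + 1)) (x 0) = _
    rw [hneg]
    have hw' := congrArg List.length hw
    have hlt := hlen (-((i + 1 : ℕ) : ℤ)) (i + 1)
    rw [List.getD_eq_getElem _ _ (by omega)]
    have hj : w[j] = w[w.length - (i + 1)] := by
      congr 1
      omega
    rw [hj]
    rcases le_total p (i + 1) with hq | hq
    · exact (hget (hsuf hq) (by omega)).symm
    · exact hget (hsuf hq) (by omega)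

/-- Nonerasing images cover every coordinate. Identities between extended points thus reduce to
checking `IsExtension`, without unfolding `extend`. -/
theorem IsExtension.unique {σ : L → List L} {x y y' : ℤ → L} (h : ∀ i, σ (x i) ≠ [])
    (hy : IsExtension σ x y) (hy' : IsExtension σ x y') : y = y' := by
  have hlen (n : ℤ) (l : ℕ) : l ≤ ((window x n l).flatMap σ).length := by
    refine (length_window x n l).symm.le.trans (length_le_length_flatMap fun a ha => ?_)
    obtain ⟨i, rfl⟩ := mem_window ha
    exact h i
  have key (n : ℤ) (l i : ℕ) (hi : i < l) (e : window y n l = window y' n l) :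
      y (n + i) = y' (n + i) := by
    have h₁ : i < (window y n l).length := by simpa
    have h₂ : i < (window y' n l).length := by simpa
    rw [← getElem_window y n l i h₁, ← getElem_window y' n l i h₂]
    simp only [e]
  funext i
  rcases le_or_gt 0 i with hi | hi
  · obtain ⟨j, rfl⟩ := Int.eq_ofNat_of_zero_le hi
    have := key 0 _ j (hlen 0 (j + 1)) ((hy.right (j + 1)).trans (hy'.right (j + 1)).symm)
    simpa using this
  · obtain ⟨j, rfl⟩ : ∃ j : ℕ, i = -j := ⟨(-i).toNat, by omega⟩
    have hj := hlen (-(j : ℤ)) j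
    have := key _ _ (((window x (-(j : ℤ)) j).flatMap σ).length - j) (by omega)
      ((hy.left j).trans (hy'.left j).symm)
    rwa [Nat.cast_sub hj, neg_add_eq_sub, sub_sub_cancel_left] at this

theorem IsExtension.shift {σ : L → List L} {x y : ℤ → L} (h : IsExtension σ x y) :
    IsExtension σ (shift x) (SAdic.shift^[(σ (x 0)).length] y) := by
  have h₁ : window y 0 (σ (x 0)).length = σ (x 0) := by simpa using h.right 1
  constructor
  · intro q
    have e := h.right (1 + q)
    rw [window_add, List.flatMap_append, List.length_append, window_add] at e
    simp only [window_one, List.flatMap_singleton, Nat.cast_one, h₁] at e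
    rw [window_shift, window_iterate_shift]
    exact List.append_cancel_left e
  · intro p
    rw [window_shift, window_iterate_shift]
    cases p with
    | zero => simp
    | succ p =>
      have hp : -((p + 1 : ℕ) : ℤ) + 1 = -p := by push_cast; ring
      rw [hp, window_add, List.flatMap_append, List.length_append, window_add]
      simp only [neg_add_cancel, window_one, List.flatMap_singleton]
      have e₁ : -((((window x (-p) p).flatMap σ).length + (σ (x 0)).length : ℕ) : ℤ) +
          ((σ (x 0)).length : ℤ) = -((window x (-p) p).flatMap σ).length := by
        push_cast
        ring
      rw [e₁, h.left, neg_add_cancel, h₁]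

theorem IsExtension.comp {σ ρ : L → List L} {x y z : ℤ → L} (h : IsExtension ρ x y)
    (h' : IsExtension σ y z) : IsExtension (fun a => (ρ a).flatMap σ) x z := by
  constructor
  · intro q
    rw [← List.flatMap_assoc, ← h.right q]
    exact h'.right _
  · intro p
    rw [← List.flatMap_assoc, ← h.left p]
    exact h'.left _

theorem isExtension_singleton (x : ℤ → L) : IsExtension (fun a => [a]) x x := by
  constructor <;> intro q <;> simp

theorem extend_shift {σ : L → List L} {x : ℤ → L} (h : ∀ i, σ (x i) ≠ []) :
    extend σ (shift x) = shift^[(σ (x 0)).length] (extend σ x) :=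
  (isExtension_extend fun i => h (i + 1)).unique (fun i => h (i + 1)) (isExtension_extend h).shift

theorem extend_flatMap {σ ρ : L → List L} {x : ℤ → L} (h : ∀ i, ρ (x i) ≠ [])
    (h' : ∀ i, σ (extend ρ x i) ≠ []) (h'' : ∀ i, (ρ (x i)).flatMap σ ≠ []) :
    extend (fun a => (ρ a).flatMap σ) x = extend σ (extend ρ x) :=
  (isExtension_extend h'').unique h'' ((isExtension_extend h).comp (isExtension_extend h'))

theorem extend_singleton (x : ℤ → L) : extend (fun a => [a]) x = x :=
  (isExtension_extend (by simp)).unique (by simp) (isExtension_singleton x)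

/-- Every window of `y` is covered by the image of a window of `x`. -/
theorem IsExtension.exists_isInfix {σ : L → List L} {x y : ℤ → L} (h : ∀ i, σ (x i) ≠ [])
    (hy : IsExtension σ x y) (m : ℤ) (l : ℕ) :
    ∃ n k, window y m l <:+: (window x n k).flatMap σ := by
  have hlen (n : ℤ) (l : ℕ) : l ≤ ((window x n l).flatMap σ).length := by
    refine (length_window x n l).symm.le.trans (length_le_length_flatMap fun a ha => ?_)
    obtain ⟨i, rfl⟩ := mem_window ha
    exact h i
  set p := m.natAbs
  set q := m.natAbs + l
  refine ⟨-p, p + q, ?_⟩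
  have hp := hlen (-p) p
  have hq := hlen 0 q
  have e := window_add y (-((window x (-p) p).flatMap σ).length)
    ((window x (-p) p).flatMap σ).length ((window x 0 q).flatMap σ).length
  rw [hy.left, neg_add_cancel, hy.right] at e
  rw [window_add, List.flatMap_append, neg_add_cancel, ← e]
  exact window_isInfix y (by omega) (by push_cast; omega)

theorem window_extend_zero {σ : L → List L} {x : ℤ → L} (h : ∀ i, σ (x i) ≠ []) :
    window (extend σ x) 0 (σ (x 0)).length = σ (x 0) := by
  simpa using (isExtension_extend h).right 1

end Words

end SAdic

namespace SAdic

namespace DirectiveSequence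

/-! ### Composed morphisms, recognizability and heights. -/

section Combinatorics

variable {L : Type*} (τ : DirectiveSequence L)

theorem mem_alphabet_of_mem_block {n k : ℕ} {a b : L} (ha : a ∈ τ.alphabet (n + k))
    (hb : b ∈ τ.block n k a) : b ∈ τ.alphabet n := by
  induction k generalizing a with
  | zero =>
    obtain rfl : b = a := by simpa [block] using hb
    exact ha
  | succ k ih =>
    obtain ⟨c, hc, hb⟩ := List.mem_flatMap.1 hb
    exact ih (τ.map_mem _ a ha c hc) hb

theorem block_ne_nil {n k : ℕ} {a : L} (ha : a ∈ τ.alphabet (n + k)) : τ.block n k a ≠ [] := by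
  induction k generalizing a with
  | zero => simp [block]
  | succ k ih =>
    obtain ⟨c, hc⟩ := List.exists_mem_of_ne_nil _ (τ.nonerasing _ a ha)
    obtain ⟨b, hb⟩ := List.exists_mem_of_ne_nil _ (ih (τ.map_mem _ a ha c hc))
    exact List.ne_nil_of_mem (List.mem_flatMap.2 ⟨c, hc, hb⟩)

theorem block_zero_ne_nil {n : ℕ} {a : L} (ha : a ∈ τ.alphabet n) : τ.block 0 n a ≠ [] :=
  τ.block_ne_nil (by rwa [zero_add])

theorem block_add (n j k : ℕ) (a : L) :
    τ.block n (j + k) a = (τ.block (n + j) k a).flatMap (τ.block n j) := by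
  induction k generalizing a with
  | zero => simp [block]
  | succ k ih =>
    have h : τ.block n (j + k) = fun b => (τ.block (n + j) k b).flatMap (τ.block n j) :=
      funext ih
    change (τ.map (n + (j + k)) a).flatMap (τ.block n (j + k)) =
      ((τ.map (n + j + k) a).flatMap (τ.block (n + j) k)).flatMap (τ.block n j)
    rw [List.flatMap_assoc, h, add_assoc]

theorem block_one (n : ℕ) : τ.block n 1 = τ.map n := by
  funext a
  simp [block]

theorem block_succ_eq (n k : ℕ) (a : L) :
    τ.block n (k + 1) a = (τ.block (n + 1) k a).flatMap (τ.map n) := by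
  rw [add_comm k 1, block_add, block_one]

theorem block_zero_succ (n : ℕ) :
    τ.block 0 (n + 1) = fun a => (τ.map n a).flatMap (τ.block 0 n) := by
  funext a
  rw [block_add, zero_add, block_one]

variable {τ}

theorem mem_alphabet_of_mem_levelSubshift {n : ℕ} {x : ℤ → L} (hx : x ∈ τ.levelSubshift n)
    (i : ℤ) : x i ∈ τ.alphabet n := by
  obtain ⟨k, -, a, ha, h⟩ := hx i 1
  exact τ.mem_alphabet_of_mem_block ha (h.subset (by simp))

theorem iterate_shift_mem {n : ℕ} {x : ℤ → L} (hx : x ∈ τ.levelSubshift n) (k : ℕ) :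
    shift^[k] x ∈ τ.levelSubshift n := by
  induction k with
  | zero => exact hx
  | succ k ih =>
    rw [Function.iterate_succ_apply']
    exact τ.shift_mem n ih

theorem extend_map_mem {n : ℕ} {x : ℤ → L} (hx : x ∈ τ.levelSubshift (n + 1)) :
    extend (τ.map n) x ∈ τ.levelSubshift n := by
  have hne (i : ℤ) : τ.map n (x i) ≠ [] :=
    τ.nonerasing n _ (mem_alphabet_of_mem_levelSubshift hx i)
  intro m l
  obtain ⟨m', l', h⟩ := (isExtension_extend hne).exists_isInfix hne m l
  obtain ⟨k, -, a, ha, s, t, hst⟩ := hx m' l'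
  refine ⟨k + 1, k.succ_pos, a, by rwa [add_comm k, ← add_assoc], h.trans ?_⟩
  rw [block_succ_eq, ← hst, List.flatMap_append, List.flatMap_append]
  exact List.infix_append _ _ _

theorem extend_block_succ {n : ℕ} {x : ℤ → L} (hx : x ∈ τ.levelSubshift (n + 1)) :
    extend (τ.block 0 (n + 1)) x = extend (τ.block 0 n) (extend (τ.map n) x) := by
  have hx' := extend_map_mem hx
  rw [block_zero_succ]
  refine extend_flatMap (fun i => τ.nonerasing n _ (mem_alphabet_of_mem_levelSubshift hx i))
    (fun i => τ.block_zero_ne_nil (mem_alphabet_of_mem_levelSubshift hx' i)) fun i => ?_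
  have := τ.block_zero_ne_nil (mem_alphabet_of_mem_levelSubshift hx i)
  rwa [block_zero_succ] at this

theorem extend_block_shift {n : ℕ} {x : ℤ → L} (hx : x ∈ τ.levelSubshift n) :
    extend (τ.block 0 n) (shift x) = shift^[τ.height n (x 0)] (extend (τ.block 0 n) x) :=
  extend_shift fun i => τ.block_zero_ne_nil (mem_alphabet_of_mem_levelSubshift hx i)

theorem extend_block_iterate_shift {n : ℕ} {x : ℤ → L} (hx : x ∈ τ.levelSubshift n) (j : ℕ) :
    extend (τ.block 0 n) (shift^[j] x) =
      shift^[((window x 0 j).flatMap (τ.block 0 n)).length] (extend (τ.block 0 n) x) := by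
  induction j with
  | zero => simp
  | succ j ih =>
    rw [Function.iterate_succ_apply', extend_block_shift (iterate_shift_mem hx j), ih,
      ← Function.iterate_add_apply, window_add, List.flatMap_append, List.length_append,
      iterate_shift_apply]
    simp [height, add_comm]

/-- Every position in an image word lies in the image of a letter. -/
theorem exists_lt_length_flatMap {σ : L → List L} (w : List L) (k : ℕ)
    (hk : k < (w.flatMap σ).length) :
    ∃ (j : ℕ) (hj : j < w.length) (i : ℕ), i < (σ w[j]).length ∧
      k = ((w.take j).flatMap σ).length + i := by
  induction w generalizing k with
  | nil => simp at hk
  | cons a w ih =>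
    rw [List.flatMap_cons, List.length_append] at hk
    rcases lt_or_ge k (σ a).length with h | h
    · exact ⟨0, by simp, k, by simpa using h, by simp⟩
    · obtain ⟨j, hj, i, hi, e⟩ := ih (k - (σ a).length) (by omega)
      refine ⟨j + 1, by simpa using hj, i, by simpa using hi, ?_⟩
      rw [List.take_succ_cons, List.flatMap_cons, List.length_append]
      omega

theorem take_window (x : ℤ → L) (n : ℤ) {j l : ℕ} (h : j ≤ l) :
    (window x n l).take j = window x n j := by
  obtain ⟨i, rfl⟩ := Nat.exists_eq_add_of_le h
  rw [window_add, List.take_left' (by simp)]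

/-- Desubstitution of a level of a tower of order `n + 1`: position `k` falls in the image of the
`j`-th letter of `τ_n(x_0)`, with offset `i`. -/
theorem exists_iterate_shift_extend {n : ℕ} {x : ℤ → L} (hx : x ∈ τ.levelSubshift (n + 1))
    {k : ℕ} (hk : k < (τ.block 0 (n + 1) (x 0)).length) :
    ∃ j < (τ.map n (x 0)).length, ∃ i,
      i < (τ.block 0 n (shift^[j] (extend (τ.map n) x) 0)).length ∧
      k = ((window (extend (τ.map n) x) 0 j).flatMap (τ.block 0 n)).length + i ∧
      shift^[k] (extend (τ.block 0 (n + 1)) x) =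
        shift^[i] (extend (τ.block 0 n) (shift^[j] (extend (τ.map n) x))) := by
  have hne (i : ℤ) : τ.map n (x i) ≠ [] :=
    τ.nonerasing n _ (mem_alphabet_of_mem_levelSubshift hx i)
  set z := extend (τ.map n) x with hz
  have hw : window z 0 (τ.map n (x 0)).length = τ.map n (x 0) := window_extend_zero hne
  rw [block_zero_succ] at hk
  obtain ⟨j, hj, i, hi, e⟩ := exists_lt_length_flatMap _ k hk
  have hzj : (τ.map n (x 0))[j] = z j := by
    have : j < (window z 0 (τ.map n (x 0)).length).length := by simpa using hj
    have h₂ := getElem_window z 0 _ j this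
    simp only [hw, zero_add] at h₂
    exact h₂
  have ht : (τ.map n (x 0)).take j = window z 0 j := by
    conv_lhs => rw [← hw]
    exact take_window _ _ hj.le
  rw [ht] at e
  refine ⟨j, hj, i, ?_, e, ?_⟩
  · rwa [iterate_shift_apply, zero_add, ← hzj]
  · rw [extend_block_succ hx, extend_block_iterate_shift (extend_map_mem hx),
      ← Function.iterate_add_apply, e, add_comm]

/-- After desubstitution, the induction hypothesis identifies the offset `i` and the point of level
`n`; recognizability of `τ_n` then identifies `j` and `x`, and `k` is determined by these. -/
theorem IsRecognizable.block (h : τ.IsRecognizable) (n : ℕ) :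
    RecognizableIn (τ.block 0 n) (τ.levelSubshift n) := by
  induction n with
  | zero =>
    intro y x hx x' hx' k k' hk hk' e e'
    have hb : τ.block 0 0 = fun a => [a] := rfl
    rw [hb] at hk hk' e e'
    obtain rfl : k = 0 := by simpa using hk
    obtain rfl : k' = 0 := by simpa using hk'
    rw [extend_singleton] at e e'
    exact ⟨rfl, e.symm.trans e'⟩
  | succ n ih =>
    intro y x hx x' hx' k k' hk hk' e e'
    obtain ⟨j, hj, i, hi, hki, hs⟩ := exists_iterate_shift_extend hx hk
    obtain ⟨j', hj', i', hi', hki', hs'⟩ := exists_iterate_shift_extend hx' hk'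
    obtain ⟨rfl, hz⟩ := ih y _ (iterate_shift_mem (extend_map_mem hx) j) _
      (iterate_shift_mem (extend_map_mem hx') j') i i' hi hi' (e.trans hs) (e'.trans hs')
    obtain ⟨rfl, rfl⟩ := h n _ x hx x' hx' j j' hj hj' rfl hz
    exact ⟨hki.trans hki'.symm, rfl⟩

theorem coe_iterate_S (k : ℕ) (y : τ.Subshift) :
    ((τ.S^[k] y : τ.Subshift) : ℤ → L) = shift^[k] y := by
  induction k with
  | zero => rfl
  | succ k ih => rw [Function.iterate_succ_apply', Function.iterate_succ_apply', ← ih]; rfl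

theorem S_injective : Function.Injective τ.S := by
  intro x y h
  refine Subtype.ext (funext fun i => ?_)
  have := congrFun (congrArg Subtype.val h) (i - 1)
  simpa [S, shift] using this

theorem iterate_S_mem_base {n : ℕ} {a : L} {y : τ.Subshift} (hy : y ∈ τ.base n a) :
    ∃ b ∈ τ.alphabet n, τ.S^[τ.height n a] y ∈ τ.base n b := by
  obtain ⟨x, hx, rfl, e⟩ := hy
  refine ⟨x 1, mem_alphabet_of_mem_levelSubshift hx 1, shift x, τ.shift_mem n hx, rfl, ?_⟩
  rw [coe_iterate_S, e, extend_block_shift hx]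

/-- A point of the base `B_n(a)` starts with the word `τ_{[0,n)}(a)`. -/
theorem window_of_mem_base {n : ℕ} {a : L} {y : τ.Subshift} (hy : y ∈ τ.base n a) :
    window (y : ℤ → L) 0 (τ.height n a) = τ.block 0 n a := by
  obtain ⟨x, hx, rfl, e⟩ := hy
  rw [e]
  exact window_extend_zero fun i =>
    τ.block_zero_ne_nil (mem_alphabet_of_mem_levelSubshift hx i)

theorem IsRecognizable.eq_of_iterate_S_eq (h : τ.IsRecognizable) {n : ℕ} {a b : L}
    {y z : τ.Subshift} (hy : y ∈ τ.base n a) (hz : z ∈ τ.base n b) {k l : ℕ}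
    (hk : k < τ.height n a) (hl : l < τ.height n b) (e : τ.S^[k] y = τ.S^[l] z) : k = l := by
  obtain ⟨x, hx, rfl, hxy⟩ := hy
  obtain ⟨x', hx', rfl, hxz⟩ := hz
  have e' := congrArg Subtype.val e
  rw [coe_iterate_S, coe_iterate_S, hxy, hxz] at e'
  exact (h.block n _ x hx x' hx' k l hk hl rfl e').1

theorem height_pos {n : ℕ} {a : L} (ha : a ∈ τ.alphabet n) : 0 < τ.height n a :=
  List.length_pos_iff.2 (τ.block_zero_ne_nil ha)

theorem height_add (n k : ℕ) (a : L) :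
    τ.height (n + k) a = ((τ.block n k a).map (τ.height n)).sum := by
  rw [height, block_add, zero_add, List.length_flatMap]
  rfl

/-- With two letters in the alphabet, primitivity gives blocks of length at least `2`, so the
minimal height doubles along a subsequence of levels; it never decreases, since blocks are nonempty.
-/
theorem tendsto_height_atTop (hprim : τ.IsPrimitive) {n₀ : ℕ}
    (hA : ∀ n ≥ n₀, (τ.alphabet n).Nontrivial) (M : ℕ) :
    ∀ᶠ n in atTop, ∀ a ∈ τ.alphabet n, M ≤ τ.height n a := by
  have hmono {n k m : ℕ} (h : ∀ a ∈ τ.alphabet n, m ≤ τ.height n a) :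
      ∀ a ∈ τ.alphabet (n + k), (τ.block n k a).length * m ≤ τ.height (n + k) a := by
    intro a ha
    rw [height_add, ← smul_eq_mul, ← List.length_map (τ.height n)]
    refine List.card_nsmul_le_sum _ _ fun i hi => ?_
    obtain ⟨b, hb, rfl⟩ := List.mem_map.1 hi
    exact h b (τ.mem_alphabet_of_mem_block ha hb)
  suffices h : ∃ n, ∀ a ∈ τ.alphabet n, M ≤ τ.height n a by
    obtain ⟨n, hn⟩ := h
    filter_upwards [eventually_ge_atTop n] with m hm a ha
    obtain ⟨k, rfl⟩ := Nat.exists_eq_add_of_le hm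
    have h₁ := hmono hn a ha
    have h₂ := List.length_pos_iff.2 (τ.block_ne_nil ha)
    exact (Nat.le_mul_of_pos_left M h₂).trans h₁
  -- With `M + 1` in place of `M` the induction starts from a positive height, so that doubling
  -- yields strict growth.
  suffices h : ∃ n ≥ n₀, ∀ a ∈ τ.alphabet n, M + 1 ≤ τ.height n a by
    obtain ⟨n, -, hn⟩ := h
    exact ⟨n, fun a ha => (Nat.le_succ M).trans (hn a ha)⟩
  induction M with
  | zero => exact ⟨n₀, le_rfl, fun a ha => height_pos ha⟩
  | succ M ih =>
    obtain ⟨n, hn, h⟩ := ih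
    obtain ⟨k, -, hk⟩ := hprim n
    refine ⟨n + k, by omega, fun a ha => ?_⟩
    have h₁ := hmono h a ha
    obtain ⟨b, hb, c, hc, hbc⟩ := hA n hn
    have h₂ : 2 ≤ (τ.block n k a).length := by
      by_contra hlt
      have hb' := hk a ha b hb
      have hc' := hk a ha c hc
      have := List.length_pos_of_mem hb'
      obtain ⟨d, hd⟩ := List.length_eq_one_iff.1 (by omega : (τ.block n k a).length = 1)
      rw [hd, List.mem_singleton] at hb' hc'
      exact hbc (hb'.trans hc'.symm)
    nlinarith

/-- On the base over the only letter of an alphabet, the return map is the identity. -/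
theorem iterate_S_eq_self_of_alphabet_subsingleton {n : ℕ} {a : L}
    (hA : ∀ b ∈ τ.alphabet n, b = a) {y : τ.Subshift} (hy : y ∈ τ.base n a) :
    τ.S^[τ.height n a] y = y := by
  obtain ⟨x, hx, hx0, e⟩ := hy
  have hs : shift x = x := funext fun i =>
    (hA _ (mem_alphabet_of_mem_levelSubshift hx _)).trans
      (hA _ (mem_alphabet_of_mem_levelSubshift hx _)).symm
  have := extend_block_shift hx
  rw [hs, hx0] at this
  exact Subtype.ext (by rw [coe_iterate_S, e, ← this])

end Combinatorics

end DirectiveSequence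

/-! ### Compactness of the subshift and closedness of the bases. -/

section Topology

theorem continuous_shift {L : Type*} [TopologicalSpace L] :
    Continuous (shift : (ℤ → L) → ℤ → L) :=
  continuous_pi fun i => continuous_apply (i + 1)

theorem DirectiveSequence.continuous_S {L : Type*} [TopologicalSpace L]
    (τ : DirectiveSequence L) : Continuous τ.S :=
  (continuous_shift.comp continuous_subtype_val).subtype_mk _

variable {L : Type*} [TopologicalSpace L] [DiscreteTopology L]

theorem isLocallyConstant_apply (i : ℤ) : IsLocallyConstant fun x : ℤ → L => x i :=
  (IsLocallyConstant.iff_continuous _).2 (continuous_apply i)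

theorem isLocallyConstant_window (n : ℤ) (l : ℕ) :
    IsLocallyConstant fun x : ℤ → L => window x n l := by
  induction l with
  | zero => exact IsLocallyConstant.const _
  | succ l ih =>
    simp only [window_add, window_one]
    exact (ih.prodMk (isLocallyConstant_apply (n + l))).comp fun p => p.1 ++ [p.2]

theorem continuous_extend (σ : L → List L) : Continuous (extend σ) := by
  refine continuous_pi fun i => IsLocallyConstant.continuous ?_
  cases i with
  | ofNat i =>
    exact ((isLocallyConstant_window 0 (i + 1)).prodMk (isLocallyConstant_apply 0)).comp
      fun p => (p.1.flatMap σ).getD i p.2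
  | negSucc j =>
    exact ((isLocallyConstant_window (Int.negSucc j) (j + 1)).prodMk
      (isLocallyConstant_apply 0)).comp
      fun p => (p.1.flatMap σ).getD ((p.1.flatMap σ).length - (j + 1)) p.2

namespace DirectiveSequence

variable (τ : DirectiveSequence L)

theorem isClosed_levelSubshift (n : ℕ) : IsClosed (τ.levelSubshift n) := by
  have : τ.levelSubshift n =
      ⋂ (m : ℤ) (l : ℕ), (fun x => window x m l) ⁻¹' τ.language n := by
    ext x
    simp [levelSubshift]
  rw [this]
  exact isClosed_iInter fun m => isClosed_iInter fun l =>
    ⟨isLocallyConstant_window m l (τ.language n)ᶜ⟩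

theorem isCompact_levelSubshift (n : ℕ) : IsCompact (τ.levelSubshift n) :=
  (isCompact_univ_pi fun _ : ℤ => (τ.alphabet n).finite_toSet.isCompact).of_isClosed_subset
    (τ.isClosed_levelSubshift n) fun _ hx i _ => mem_alphabet_of_mem_levelSubshift hx i

instance : CompactSpace τ.Subshift :=
  isCompact_iff_compactSpace.1 (τ.isCompact_levelSubshift 0)

theorem isClosed_base (n : ℕ) (a : L) : IsClosed (τ.base n a) := by
  have : τ.base n a = Subtype.val ⁻¹' (extend (τ.block 0 n) ''
      (τ.levelSubshift n ∩ (fun x => x 0) ⁻¹' {a})) := by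
    ext y
    simp only [base, Set.mem_ofPred_eq, Set.mem_preimage, Set.mem_image, Set.mem_inter_iff,
      Set.mem_singleton_iff, and_assoc, eq_comm]
  rw [this]
  refine IsClosed.preimage continuous_subtype_val (IsCompact.isClosed ?_)
  refine IsCompact.image ?_ (continuous_extend _)
  exact (τ.isCompact_levelSubshift n).inter_right
    ((isClosed_discrete {a}).preimage (continuous_apply 0))

/-- A continuous function on the subshift is almost determined by a central window. -/
theorem exists_forall_dist_lt {g : τ.Subshift → ℂ} (hg : Continuous g) {ε : ℝ} (hε : 0 < ε) :
    ∃ m : ℕ, ∀ x y : τ.Subshift, (∀ i : ℤ, |i| ≤ m → x.1 i = y.1 i) → dist (g x) (g y) < ε := by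
  by_contra! hcon
  -- The pairs violating the claim for radius `m` form nested nonempty compact sets; a common point
  -- would lie on the diagonal, where the distance is `0`.
  let K (m : ℕ) : Set (τ.Subshift × τ.Subshift) :=
    {p | ε ≤ dist (g p.1) (g p.2)} ∩ ⋂ (i : ℤ) (_ : |i| ≤ m), {p | p.1.1 i = p.2.1 i}
  have hK (m : ℕ) : IsClosed (K m) := by
    refine (isClosed_le continuous_const (by fun_prop)).inter ?_
    refine isClosed_iInter fun i => isClosed_iInter fun _ => isClosed_eq ?_ ?_
    · exact (continuous_apply i).comp (continuous_subtype_val.comp continuous_fst)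
    · exact (continuous_apply i).comp (continuous_subtype_val.comp continuous_snd)
  obtain ⟨p, hp⟩ := IsCompact.nonempty_iInter_of_sequence_nonempty_isCompact_isClosed K
    (fun m p hp => ⟨hp.1, by
      have := hp.2
      simp only [Set.mem_iInter] at this ⊢
      exact fun i hi => this i (hi.trans (by push_cast; linarith))⟩)
    (fun m => by
      obtain ⟨x, y, h, h'⟩ := hcon m
      exact ⟨(x, y), h', by simpa using h⟩)
    (hK 0).isCompact hK
  simp only [Set.mem_iInter] at hp
  have hpe : p.1 = p.2 := by
    refine Subtype.ext (funext fun i => ?_)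
    have := (hp i.natAbs).2
    simp only [Set.mem_iInter] at this
    exact this i (by simp)
  have h₀ := (hp 0).1
  rw [Set.mem_ofPred_eq, hpe, dist_self] at h₀
  linarith

end DirectiveSequence

end Topology

end SAdic

namespace SAdic

/-! ### Eigenfunctions of measure-preserving maps. -/

section Dynamics

variable {X : Type*} [MeasurableSpace X] {μ : Measure X} {T : X → X}

theorem measurableEmbedding_iterate (hT' : MeasurableEmbedding T) (k : ℕ) :
    MeasurableEmbedding T^[k] := by
  induction k with
  | zero => exact MeasurableEmbedding.id
  | succ k ih => exact ih.comp hT'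

theorem measureReal_image_iterate (hT : MeasurePreserving T μ μ) (hT' : MeasurableEmbedding T)
    (k : ℕ) (E : Set X) : μ.real (T^[k] '' E) = μ.real E := by
  have h := (hT.iterate k).measure_preimage_emb (measurableEmbedding_iterate hT' k) (T^[k] '' E)
  rw [Set.preimage_image_eq _ (hT'.injective.iterate k)] at h
  rw [measureReal_def, measureReal_def, h]

theorem measureReal_biUnion_image_iterate [IsFiniteMeasure μ] (hT : MeasurePreserving T μ μ)
    (hT' : MeasurableEmbedding T) {E : Set X} (hE : MeasurableSet E) (s : Finset ℕ)
    (hs : ∀ k ∈ s, ∀ l ∈ s, ∀ x ∈ E, ∀ y ∈ E, T^[k] x = T^[l] y → k = l) :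
    μ.real (⋃ k ∈ s, T^[k] '' E) = s.card * μ.real E := by
  rw [measureReal_biUnion_finset]
  · simp [measureReal_image_iterate hT hT']
  · intro k hk l hl hkl
    refine Set.disjoint_left.2 ?_
    rintro _ ⟨x, hx, rfl⟩ ⟨y, hy, e⟩
    exact hkl (hs k hk l hl x hx y hy e.symm)
  · exact fun k _ => (measurableEmbedding_iterate hT' k).measurableSet_image.2 hE

theorem comp_iterate_ae_eq (hT : MeasurePreserving T μ μ) {f : X → ℂ} {z : ℂ}
    (hf : f ∘ T =ᵐ[μ] fun x => z * f x) (k : ℕ) :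
    f ∘ T^[k] =ᵐ[μ] fun x => z ^ k * f x := by
  induction k with
  | zero => simp
  | succ k ih =>
    have h := hT.quasiMeasurePreserving.ae_eq_comp ih
    filter_upwards [h, hf] with x hx hx'
    simp only [Function.comp_apply] at hx hx' ⊢
    rw [Function.iterate_succ_apply, hx, hx', pow_succ, mul_assoc]

theorem norm_eq_const_of_eigenfunction (hT : Ergodic T μ) {f : X → ℂ} {z : ℂ} (hz : ‖z‖ = 1)
    (hfm : AEStronglyMeasurable f μ) (h0 : ¬ f =ᵐ[μ] 0)
    (hf : f ∘ T =ᵐ[μ] fun x => z * f x) : ∃ r : ℝ, 0 < r ∧ ∀ᵐ x ∂μ, ‖f x‖ = r := by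
  obtain ⟨r, hr⟩ := hT.ae_eq_const_of_ae_eq_comp_ae (g := fun x => ‖f x‖) hfm.norm (by
    filter_upwards [hf] with x hx
    simp only [Function.comp_apply] at hx ⊢
    rw [hx, norm_mul, hz, one_mul])
  refine ⟨r, ?_, hr⟩
  by_contra hneg
  refine h0 ?_
  filter_upwards [hr] with x hx
  simp only [Function.const_apply] at hx
  exact norm_le_zero_iff.1 (hx.trans_le (not_lt.1 hneg))

/-- If an approximation `g` of an eigenfunction of modulus `r` is almost invariant under `T^h` on
`D`, then `z ^ h` is close to `1` unless `D` is small. -/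
theorem norm_pow_sub_one_mul_measureReal_le [IsProbabilityMeasure μ]
    (hT : MeasurePreserving T μ μ) (hT' : MeasurableEmbedding T) {f g : X → ℂ} {z : ℂ} {r ε : ℝ}
    (hr : ∀ᵐ x ∂μ, ‖f x‖ = r) (hf : f ∘ T =ᵐ[μ] fun x => z * f x)
    (hfi : Integrable f μ) (hgi : Integrable g μ) (hfg : ∫ x, ‖f x - g x‖ ∂μ ≤ ε)
    {D : Set X} (hD : MeasurableSet D) {h : ℕ} (hε : 0 ≤ ε)
    (hgD : ∀ x ∈ D, ‖g (T^[h] x) - g x‖ ≤ ε) :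
    r * ‖z ^ h - 1‖ * μ.real D ≤ 3 * ε := by
  have hh := hT.iterate h
  have hh' := measurableEmbedding_iterate hT' h
  set F : X → ℝ := fun x => ‖f x - g x‖ with hF
  have hFi : Integrable F μ := (hfi.sub hgi).norm
  have hFi' : Integrable (fun x => F (T^[h] x)) μ := (hh.integrable_comp_emb hh').2 hFi
  have hFi'' : IntegrableOn (fun x => F (T^[h] x) + ε) D μ :=
    hFi'.integrableOn.add integrableOn_const
  have hF0 (x : X) : 0 ≤ F x := norm_nonneg _
  have h₁ : ∫ x, F (T^[h] x) ∂μ ≤ ε := by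
    rw [hh.integral_comp hh']
    exact hfg
  have h₂ : ∫ x in D, F (T^[h] x) ∂μ ≤ ∫ x, F (T^[h] x) ∂μ :=
    setIntegral_le_integral hFi' (ae_of_all _ fun x => hF0 _)
  have h₃ : ∫ x in D, F x ∂μ ≤ ∫ x, F x ∂μ :=
    setIntegral_le_integral hFi (ae_of_all _ fun x => hF0 _)
  have h₄ : ∫ _ in D, ε ∂μ ≤ ε := by
    rw [setIntegral_const, smul_eq_mul]
    exact mul_le_of_le_one_left hε measureReal_le_one
  -- The constant `r ‖z ^ h - 1‖` equals `‖f (T^[h] x) - f x‖`; passing through `g` splits it into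
  -- three terms, each with integral at most `ε` over `D`.
  have h₅ : ∫ _ in D, r * ‖z ^ h - 1‖ ∂μ ≤ ∫ x in D, (F (T^[h] x) + ε + F x) ∂μ := by
    refine setIntegral_mono_on_ae integrableOn_const
      (hFi''.add hFi.integrableOn) hD ?_
    filter_upwards [hr, comp_iterate_ae_eq hT hf h] with x hx hx' hxD
    have e : r * ‖z ^ h - 1‖ = ‖f (T^[h] x) - f x‖ := by
      simp only [Function.comp_apply] at hx'
      rw [hx', ← hx, ← norm_mul]
      congr 1
      ring
    have e' : f (T^[h] x) - f x =
        (f (T^[h] x) - g (T^[h] x)) + (g (T^[h] x) - g x) - (f x - g x) := by ring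
    rw [e, e']
    refine (norm_sub_le _ _).trans ?_
    have := norm_add_le (f (T^[h] x) - g (T^[h] x)) (g (T^[h] x) - g x)
    have := hgD x hxD
    simp only [hF]
    linarith
  rw [setIntegral_const, smul_eq_mul, integral_add hFi'' hFi.integrableOn,
    integral_add hFi'.integrableOn integrableOn_const] at h₅
  nlinarith

end Dynamics

/-! ### Distance to the nearest integer, and extremal lengths. -/

theorem distInt_nonneg (x : ℝ) : 0 ≤ distInt x := le_ciInf fun _ => abs_nonneg _

theorem distInt_le_abs_sub (x : ℝ) (m : ℤ) : distInt x ≤ |x - m| :=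
  ciInf_le ⟨0, by rintro _ ⟨m, rfl⟩; exact abs_nonneg _⟩ m

/-- With `t = x - round x`, the right side is `2 |sin (πt)|`, and `|t| ≤ 1/2` allows Jordan's
inequality `sin s ≥ 2s/π` on `[0, π/2]`. -/
theorem four_mul_distInt_le (x : ℝ) :
    4 * distInt x ≤ ‖Complex.exp (2 * (Real.pi : ℂ) * Complex.I * (x : ℂ)) - 1‖ := by
  set t : ℝ := x - round x with ht
  have hexp : Complex.exp (2 * (Real.pi : ℂ) * Complex.I * (x : ℂ)) =
      Complex.exp (Complex.I * ((2 * Real.pi * t : ℝ) : ℂ)) := by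
    rw [Complex.exp_eq_exp_iff_exists_int]
    refine ⟨round x, ?_⟩
    simp only [ht]
    push_cast
    ring
  have h₁ : |t| ≤ 1 / 2 := abs_sub_round x
  have h₂ : 2 / Real.pi * (Real.pi * |t|) ≤ Real.sin (Real.pi * |t|) :=
    Real.mul_le_sin (by positivity) (by nlinarith [Real.pi_pos])
  have h₃ : 2 / Real.pi * (Real.pi * |t|) = 2 * |t| := by
    field_simp
  have h₄ : |Real.sin (Real.pi * |t|)| = |Real.sin (Real.pi * t)| := by
    rcases abs_choice t with h | h
    · rw [h]
    · rw [h, mul_neg, Real.sin_neg, abs_neg]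
  rw [hexp, Complex.norm_exp_I_mul_ofReal_sub_one, Real.norm_eq_abs, abs_mul, abs_two]
  have h₅ : 2 * Real.pi * t / 2 = Real.pi * t := by ring
  rw [h₅, ← h₄]
  have := le_abs_self (Real.sin (Real.pi * |t|))
  have := distInt_le_abs_sub x (round x)
  linarith

theorem le_maxLength {L : Type*} {A : Finset L} (σ : L → List L) {a : L} (ha : a ∈ A) :
    (σ a).length ≤ maxLength A σ :=
  le_ciSup (f := fun a : A => (σ a).length) (Set.finite_range _).bddAbove ⟨a, ha⟩

theorem minLength_le {L : Type*} {A : Finset L} (σ : L → List L) {a : L} (ha : a ∈ A) :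
    minLength A σ ≤ (σ a).length :=
  ciInf_le (f := fun a : A => (σ a).length) (OrderBot.bddBelow _) ⟨a, ha⟩

theorem exists_length_eq_minLength {L : Type*} {A : Finset L} (hA : A.Nonempty)
    (σ : L → List L) : ∃ a ∈ A, (σ a).length = minLength A σ := by
  have : Nonempty A := hA.to_subtype
  obtain ⟨a, ha⟩ := exists_eq_ciInf_of_finite (f := fun a : A => (σ a).length)
  exact ⟨a, a.2, ha⟩

/-! ### Masses of towers and return sets. -/

namespace DirectiveSequence

variable {L : Type*} {τ : DirectiveSequence L}

theorem apply_eq_of_mem_base {n c d : ℕ} {a b : L} {u : List L}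
    (ha : ((τ.block 0 n a).take d).drop c = u) (hb : ((τ.block 0 n b).take d).drop c = u)
    (hda : d ≤ τ.height n a) (hdb : d ≤ τ.height n b) {y z : τ.Subshift}
    (hy : y ∈ τ.base n a) (hz : z ∈ τ.base n b) {j : ℕ} (hc : c ≤ j) (hd : j < d) :
    y.1 j = z.1 j := by
  have key {a : L} (ha : ((τ.block 0 n a).take d).drop c = u) (hda : d ≤ τ.height n a)
      {y : τ.Subshift} (hy : y ∈ τ.base n a) : u[j - c]? = some (y.1 j) := by
    rw [← ha, List.getElem?_drop, Nat.add_sub_cancel' hc, List.getElem?_take_of_lt hd,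
      ← window_of_mem_base hy, List.getElem?_eq_getElem (by simp; omega), getElem_window, zero_add]
  exact Option.some.inj ((key ha hda hy).symm.trans (key hb hdb hz))

/-- The points of `B_n(a)` whose next visited base belongs to a letter of `A`. -/
def returnSet (τ : DirectiveSequence L) (n : ℕ) (a : L) (A : Finset L) : Set τ.Subshift :=
  τ.base n a ∩ τ.S^[τ.height n a] ⁻¹' ⋃ b ∈ A, τ.base n b

variable [TopologicalSpace L] [DiscreteTopology L]

theorem isClosed_returnSet (n : ℕ) (a : L) (A : Finset L) : IsClosed (τ.returnSet n a A) :=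
  (τ.isClosed_base n a).inter ((isClosed_biUnion_finset fun b _ => τ.isClosed_base n b).preimage
    (τ.continuous_S.iterate _))

variable [MeasurableSpace τ.Subshift] [BorelSpace τ.Subshift]

theorem measurableEmbedding_S : MeasurableEmbedding τ.S :=
  (τ.continuous_S.isClosedEmbedding S_injective).measurableEmbedding

/-- Recognizability makes the levels disjoint, and invariance gives each the mass of the base. -/
theorem measureReal_tower (hrec : τ.IsRecognizable) {μ : Measure τ.Subshift} [IsFiniteMeasure μ]
    (hμ : MeasurePreserving τ.S μ μ) (n : ℕ) (a : L) :
    μ.real (τ.tower n a) = τ.height n a * μ.real (τ.base n a) := by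
  have h := measureReal_biUnion_image_iterate hμ measurableEmbedding_S
    (τ.isClosed_base n a).measurableSet (Finset.range (τ.height n a))
    fun k hk l hl x hx y hy e => hrec.eq_of_iterate_S_eq hx hy (Finset.mem_range.1 hk)
      (Finset.mem_range.1 hl) e
  rw [Finset.card_range] at h
  rw [← h]
  simp [tower]

theorem measureReal_base_le {μ : Measure τ.Subshift} [IsFiniteMeasure μ]
    (hμ : MeasurePreserving τ.S μ μ) [DecidableEq L] (n : ℕ) (a : L) (A : Finset L) :
    μ.real (τ.base n a) ≤
      μ.real (τ.returnSet n a A) + ∑ b ∈ τ.alphabet n \ A, μ.real (τ.base n b) := by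
  have hsub : τ.base n a ⊆ τ.returnSet n a A ∪
      ⋃ b ∈ τ.alphabet n \ A, τ.S^[τ.height n a] ⁻¹' τ.base n b := by
    intro y hy
    obtain ⟨b, hb, hyb⟩ := iterate_S_mem_base hy
    by_cases hbA : b ∈ A
    · exact Or.inl ⟨hy, Set.mem_biUnion hbA hyb⟩
    · exact Or.inr (Set.mem_biUnion (Finset.mem_sdiff.2 ⟨hb, hbA⟩) hyb)
  refine (measureReal_mono hsub).trans ((measureReal_union_le _ _).trans ?_)
  gcongr
  refine (measureReal_biUnion_finset_le _ _).trans (Finset.sum_le_sum fun b _ => le_of_eq ?_)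
  exact (hμ.iterate _).measureReal_preimage (τ.isClosed_base n b).measurableSet.nullMeasurableSet

end DirectiveSequence

end SAdic

namespace SAdic

/-! ### Convergence of `z ^ h_n(a)` to `1`. -/

namespace DirectiveSequence

variable {L : Type*} {τ : DirectiveSequence L}

theorem height_le_mul_height {n : ℕ} {K : ℝ}
    (hK : (maxLength (τ.alphabet n) (τ.block 0 n) : ℝ) /
      (minLength (τ.alphabet n) (τ.block 0 n) : ℝ) ≤ K) {a b : L} (ha : a ∈ τ.alphabet n)
    (hb : b ∈ τ.alphabet n) : (τ.height n a : ℝ) ≤ K * τ.height n b := by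
  obtain ⟨e, he, hmin⟩ := exists_length_eq_minLength ⟨a, ha⟩ (τ.block 0 n)
  have hpos : (0 : ℝ) < minLength (τ.alphabet n) (τ.block 0 n) := by
    rw [← hmin]
    exact_mod_cast height_pos he
  have h₁ : (τ.height n a : ℝ) ≤ maxLength (τ.alphabet n) (τ.block 0 n) := by
    exact_mod_cast le_maxLength (τ.block 0 n) ha
  have h₂ : (minLength (τ.alphabet n) (τ.block 0 n) : ℝ) ≤ τ.height n b := by
    exact_mod_cast minLength_le (τ.block 0 n) hb
  have h₀ : (0 : ℝ) ≤ K := (by positivity : (0 : ℝ) ≤ _).trans hK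
  exact (h₁.trans ((div_le_iff₀ hpos).1 hK)).trans (mul_le_mul_of_nonneg_left h₂ h₀)

theorem le_levels_mul_measureReal_returnSet [MeasurableSpace τ.Subshift] {μ : Measure τ.Subshift}
    {n c d m : ℕ} {a : L} {A : Finset L} {κ ρ : ℝ} (hρ : 0 ≤ ρ)
    (hκ : κ / 2 ≤ τ.height n a * μ.real (τ.returnSet n a A))
    (hcd : ρ * τ.height n a + c ≤ d) (hm : 4 * m ≤ ρ * τ.height n a) :
    ρ * κ / 4 ≤ (d - m - (c + m) : ℕ) * μ.real (τ.returnSet n a A) := by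
  -- Cutting `2m ≤ ρ h / 2` levels from at least `ρ h` leaves at least half; the truncated
  -- subtraction only helps this lower bound.
  have h₁ : ρ / 2 * τ.height n a ≤ (d - m - (c + m) : ℕ) := by
    have : d ≤ (d - m - (c + m)) + (c + 2 * m) := by omega
    have : (d : ℝ) ≤ (d - m - (c + m) : ℕ) + (c + 2 * m) := by exact_mod_cast this
    linarith
  calc ρ * κ / 4 = ρ / 2 * (κ / 2) := by ring
    _ ≤ ρ / 2 * (τ.height n a * μ.real (τ.returnSet n a A)) := by gcongr
    _ = ρ / 2 * τ.height n a * μ.real (τ.returnSet n a A) := by ring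
    _ ≤ _ := by gcongr

variable [TopologicalSpace L] [DiscreteTopology L]
  [MeasurableSpace τ.Subshift] [BorelSpace τ.Subshift]

/-- If `g` depends up to `ε` only on the central window of radius `m` and the words of the towers
over `A` agree on `[c, d)`, then `z ^ h_n(a)` is close to `1` unless the levels between `c + m`
and `d - m` over the points returning to the bases of letters in `A` carry little mass. -/
theorem norm_pow_height_sub_one_mul_le (hrec : τ.IsRecognizable) {μ : Measure τ.Subshift}
    [IsProbabilityMeasure μ] (hμ : MeasurePreserving τ.S μ μ) {f g : τ.Subshift → ℂ} {z : ℂ}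
    {r ε : ℝ} (hr : ∀ᵐ x ∂μ, ‖f x‖ = r) (hf : f ∘ τ.S =ᵐ[μ] fun x => z * f x)
    (hfi : Integrable f μ) (hgi : Integrable g μ) (hfg : ∫ x, ‖f x - g x‖ ∂μ ≤ ε) (hε : 0 ≤ ε)
    {m : ℕ} (hg : ∀ x y : τ.Subshift, (∀ i : ℤ, |i| ≤ m → x.1 i = y.1 i) → dist (g x) (g y) ≤ ε)
    {n c d : ℕ} {a : L} {A : Finset L} {u : List L} (ha : a ∈ A)
    (hd : ∀ b ∈ A, d ≤ τ.height n b) (hu : ∀ b ∈ A, ((τ.block 0 n b).take d).drop c = u) :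
    r * ‖z ^ τ.height n a - 1‖ *
      ((d - m - (c + m) : ℕ) * μ.real (τ.returnSet n a A)) ≤ 3 * ε := by
  have hm := (isClosed_returnSet (τ := τ) n a A).measurableSet
  have hD := measureReal_biUnion_image_iterate hμ measurableEmbedding_S hm
    (Finset.Ico (c + m) (d - m)) fun k hk l hl x hx y hy e => by
      rw [Finset.mem_Ico] at hk hl
      have := hd a ha
      exact hrec.eq_of_iterate_S_eq hx.1 hy.1 (by omega) (by omega) e
  rw [Nat.card_Ico] at hD
  rw [← hD]
  refine norm_pow_sub_one_mul_measureReal_le hμ measurableEmbedding_S hr hf hfi hgi hfg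
    (Finset.measurableSet_biUnion _ fun k _ =>
      (measurableEmbedding_iterate measurableEmbedding_S k).measurableSet_image.2 hm) hε ?_
  intro x hx
  simp only [Set.mem_iUnion] at hx
  obtain ⟨k, hk, y, ⟨hya, hyb⟩, rfl⟩ := hx
  rw [Finset.mem_Ico] at hk
  simp only [Set.mem_preimage, Set.mem_iUnion] at hyb
  obtain ⟨b, hb, hyb⟩ := hyb
  rw [← dist_eq_norm]
  refine hg _ _ fun i hi => ?_
  -- Commuting the iterates places the two points at the same height `k` above the base points `S^h
  -- y` and `y`.
  rw [← Function.iterate_add_apply, add_comm, Function.iterate_add_apply, coe_iterate_S k,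
    coe_iterate_S k y, iterate_shift_apply, iterate_shift_apply]
  rw [abs_le] at hi
  obtain ⟨j, hj⟩ := Int.eq_ofNat_of_zero_le (by omega : 0 ≤ i + k)
  rw [hj]
  exact apply_eq_of_mem_base (j := j) (hu b hb) (hu a ha) (hd b hb) (hd a ha) hyb hya
    (by omega) (by omega)

/-- Multiplying `measureReal_base_le` by `h_n(a)` turns base masses into tower masses: for a letter
`b` outside `A`, `h_n(a) μ(B_n(b)) ≤ K μ(T_n(b))`. -/
theorem le_measureReal_returnSet (hrec : τ.IsRecognizable) {μ : Measure τ.Subshift}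
    [IsProbabilityMeasure μ] (hμ : MeasurePreserving τ.S μ μ) [DecidableEq L] {n : ℕ} {a : L}
    {A : Finset L} {K κ : ℝ} (hK : ∀ b ∈ τ.alphabet n, (τ.height n a : ℝ) ≤ K * τ.height n b)
    (hκ : κ ≤ μ.real (τ.tower n a))
    (hsum : K * ∑ b ∈ τ.alphabet n \ A, μ.real (τ.tower n b) ≤ κ / 2) :
    κ / 2 ≤ τ.height n a * μ.real (τ.returnSet n a A) := by
  have h₁ := mul_le_mul_of_nonneg_left (measureReal_base_le hμ n a A)
    (Nat.cast_nonneg (α := ℝ) (τ.height n a))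
  rw [measureReal_tower hrec hμ] at hκ
  have h₂ : τ.height n a * ∑ b ∈ τ.alphabet n \ A, μ.real (τ.base n b) ≤
      K * ∑ b ∈ τ.alphabet n \ A, μ.real (τ.tower n b) := by
    rw [Finset.mul_sum, Finset.mul_sum]
    refine Finset.sum_le_sum fun b hb => ?_
    rw [measureReal_tower hrec hμ, ← mul_assoc]
    exact mul_le_mul_of_nonneg_right (hK b (Finset.mem_sdiff.1 hb).1) measureReal_nonneg
  linarith

/-- The base has positive mass, hence contains a point `y` with `f y ≠ 0` at which the eigenvalue
equation holds; `y` is fixed by `S^h`. -/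
theorem pow_height_eq_one_of_alphabet_subsingleton (hrec : τ.IsRecognizable)
    {μ : Measure τ.Subshift} [IsProbabilityMeasure μ] (hμ : MeasurePreserving τ.S μ μ)
    {f : τ.Subshift → ℂ} {z : ℂ} {r : ℝ} (hr0 : 0 < r) (hr : ∀ᵐ x ∂μ, ‖f x‖ = r)
    (hf : f ∘ τ.S =ᵐ[μ] fun x => z * f x) {n : ℕ} {a : L} (hA : ∀ b ∈ τ.alphabet n, b = a)
    (hpos : 0 < μ.real (τ.tower n a)) : z ^ τ.height n a = 1 := by
  rw [measureReal_tower hrec hμ] at hpos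
  have hb : μ (τ.base n a) ≠ 0 := by
    intro h
    simp [measureReal_def, h] at hpos
  have hfreq := frequently_ae_mem_iff.2 hb
  obtain ⟨y, hy, hyr, hyf⟩ :=
    (hfreq.and_eventually (hr.and (comp_iterate_ae_eq hμ hf (τ.height n a)))).exists
  rw [Function.comp_apply, iterate_S_eq_self_of_alphabet_subsingleton hA hy] at hyf
  have hy0 : f y ≠ 0 := by
    rw [← norm_pos_iff, hyr]
    exact hr0
  exact mul_right_cancel₀ hy0 (hyf.symm.trans (one_mul _).symm)

/-- The key convergence: on the letters of the clean part, the heights become periods of the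
eigenvalue. -/
theorem tendsto_norm_pow_height_sub_one (hprim : τ.IsPrimitive) (hrec : τ.IsRecognizable)
    {μ : Measure τ.Subshift} [IsProbabilityMeasure μ] (hμ : Ergodic τ.S μ) {A : Finset L}
    (hclean : τ.IsCleanWith μ A)
    (hratio : ∃ K : ℝ, 0 < K ∧ ∀ᶠ n in atTop,
      (maxLength (τ.alphabet n) (τ.block 0 n) : ℝ) /
        (minLength (τ.alphabet n) (τ.block 0 n) : ℝ) ≤ K)
    (hword : ∃ δ : ℝ, 0 < δ ∧ ∀ᶠ n in atTop,
      ∃ u : List L, u ≠ [] ∧ (∀ b ∈ u, b ∈ τ.alphabet 0) ∧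
        ∃ c d : ℕ, c < d ∧ d ≤ minLength A (τ.block 0 n) ∧
          δ * (minLength A (τ.block 0 n) : ℝ) ≤ (u.length : ℝ) ∧
          ∀ a ∈ A, ((τ.block 0 n a).take d).drop c = u)
    {f : τ.Subshift → ℂ} {z : ℂ} {r : ℝ} (hr0 : 0 < r) (hr : ∀ᵐ x ∂μ, ‖f x‖ = r)
    (hf : f ∘ τ.S =ᵐ[μ] fun x => z * f x) (hfi : Integrable f μ) {a : L} (ha : a ∈ A) :
    Tendsto (fun n => ‖z ^ τ.height n a - 1‖) atTop (𝓝 0) := by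
  classical
  obtain ⟨n₀, hA, hAsub, ⟨κ, hκ0, hκ⟩, hsmall⟩ := hclean
  by_cases hnt : (τ.alphabet n₀).Nontrivial
  swap
  · refine tendsto_const_nhds.congr' ?_
    filter_upwards [eventually_ge_atTop n₀] with n hn
    rw [pow_height_eq_one_of_alphabet_subsingleton hrec hμ.toMeasurePreserving hr0 hr hf
      (fun b hb => ?_) (hκ0.trans_le (hκ n hn a ha)), sub_self, norm_zero]
    rw [hA n hn] at hb
    exact Set.not_nontrivial_iff.1 hnt hb (hAsub ha)
  obtain ⟨K, hK0, hK⟩ := hratio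
  obtain ⟨δ, hδ0, hδ⟩ := hword
  set ρ := δ / K with hρ
  have hρ0 : 0 < ρ := by positivity
  have hsum : ∀ᶠ n in atTop, K * ∑ b ∈ τ.alphabet n \ A, μ.real (τ.tower n b) ≤ κ / 2 := by
    have h₁ : Tendsto (fun n => K * ∑ b ∈ τ.alphabet n₀ \ A, μ.real (τ.tower n b)) atTop
        (𝓝 (K * ∑ b ∈ τ.alphabet n₀ \ A, 0)) :=
      (tendsto_finsetSum _ fun b hb =>
        hsmall b (Finset.mem_sdiff.1 hb).1 (Finset.mem_sdiff.1 hb).2).const_mul K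
    rw [Finset.sum_const_zero, mul_zero] at h₁
    filter_upwards [h₁.eventually_le_const (half_pos hκ0), eventually_ge_atTop n₀] with n hn hn'
    rwa [hA n hn']
  rw [Metric.tendsto_atTop']
  intro η hη
  -- Chosen so that `3ε` is half of `r η (ρκ/4)`, where `ρκ/4` is the lower bound for the mass of
  -- `D`.
  set ε := r * η * (ρ * κ / 4) / 6 with hε
  have hε0 : 0 < ε := by positivity
  obtain ⟨g, hfg, hgi⟩ := hfi.exists_boundedContinuous_integral_sub_le hε0
  obtain ⟨m, hm⟩ := τ.exists_forall_dist_lt g.continuous hε0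
  -- Heights of at least `4m/ρ` make the margins of width `m` negligible.
  obtain ⟨M, hM⟩ := exists_nat_ge (4 * m / ρ)
  have hheight := tendsto_height_atTop hprim (fun n hn => by rwa [hA n hn]) M
  suffices h : ∀ᶠ n in atTop, dist ‖z ^ τ.height n a - 1‖ 0 < η by
    obtain ⟨N, hN⟩ := eventually_atTop.1 h
    exact ⟨N, fun n hn => hN n hn.le⟩
  filter_upwards [hK, hδ, hsum, hheight, eventually_ge_atTop n₀]
    with n hKn hδn hsn hMn hn
  obtain ⟨u, -, -, c, d, hcd, hd, hδu, hu⟩ := hδn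
  have haA : a ∈ τ.alphabet n := by
    rw [hA n hn]
    exact hAsub ha
  have hdA (b : L) (hb : b ∈ A) : d ≤ τ.height n b := hd.trans (minLength_le _ hb)
  have hheights (b : L) (hb : b ∈ τ.alphabet n) := height_le_mul_height hKn haA hb
  have hlen : u.length + c = d := by
    have h : d ≤ (τ.block 0 n a).length := hdA a ha
    rw [← hu a ha, List.length_drop, List.length_take]
    omega
  have hρd : ρ * τ.height n a + c ≤ d := by
    obtain ⟨e, he, hmin⟩ := exists_length_eq_minLength ⟨a, ha⟩ (τ.block 0 n)
    have he' : e ∈ τ.alphabet n := by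
      rw [hA n hn]
      exact hAsub he
    have h₁ : ρ * τ.height n a ≤ δ * minLength A (τ.block 0 n) := by
      rw [← hmin, hρ, div_mul_eq_mul_div, div_le_iff₀ hK0, mul_assoc, mul_comm _ K]
      exact mul_le_mul_of_nonneg_left (hheights e he') hδ0.le
    have h₂ : (u.length : ℝ) + c = d := by exact_mod_cast hlen
    linarith
  have hmh : 4 * m ≤ ρ * τ.height n a := by
    rw [mul_comm ρ, ← div_le_iff₀ hρ0]
    exact hM.trans (by exact_mod_cast hMn a haA)
  have hlow := le_levels_mul_measureReal_returnSet (c := c) (d := d) hρ0.le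
    (le_measureReal_returnSet hrec hμ.toMeasurePreserving hheights (hκ n hn a ha) hsn) hρd hmh
  have hup := norm_pow_height_sub_one_mul_le hrec hμ.toMeasurePreserving hr hf hfi hgi hfg hε0.le
    (fun x y hxy => (hm x y hxy).le) ha hdA hu
  have hrz : r * ‖z ^ τ.height n a - 1‖ * (ρ * κ / 4) ≤ 3 * ε :=
    (mul_le_mul_of_nonneg_left hlow (by positivity)).trans hup
  rw [Real.dist_0_eq_abs, abs_norm]
  by_contra! hcon
  have hfin : r * η * (ρ * κ / 4) ≤ r * ‖z ^ τ.height n a - 1‖ * (ρ * κ / 4) := by gcongr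
  have hpos : 0 < r * η * (ρ * κ / 4) := by positivity
  linarith

end DirectiveSequence

end SAdic

theorem mainTheorem7 {L : Type*} [TopologicalSpace L] [DiscreteTopology L]
    (τ : SAdic.DirectiveSequence L)
    (hprim : τ.IsPrimitive) (hprop : τ.IsProper) (hrec : τ.IsRecognizable)
    [MeasurableSpace τ.Subshift] [BorelSpace τ.Subshift]
    (μ : Measure τ.Subshift) [IsProbabilityMeasure μ] (hμ : Ergodic τ.S μ)
    (Aμ : Finset L) (hclean : τ.IsCleanWith μ Aμ)
    (hratio : ∃ K : ℝ, 0 < K ∧ ∀ᶠ n in atTop,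
      (SAdic.maxLength (τ.alphabet n) (τ.block 0 n) : ℝ) /
        (SAdic.minLength (τ.alphabet n) (τ.block 0 n) : ℝ) ≤ K)
    (hword : ∃ δ : ℝ, 0 < δ ∧ ∀ᶠ n in atTop,
      ∃ u : List L, u ≠ [] ∧ (∀ b ∈ u, b ∈ τ.alphabet 0) ∧
        ∃ c d : ℕ, c < d ∧ d ≤ SAdic.minLength Aμ (τ.block 0 n) ∧
          δ * (SAdic.minLength Aμ (τ.block 0 n) : ℝ) ≤ (u.length : ℝ) ∧
          ∀ a ∈ Aμ, ((τ.block 0 n a).take d).drop c = u)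
    (α : ℝ)
    (heig : SAdic.IsMeasurableEigenvalue τ.S μ
      (Complex.exp (2 * (Real.pi : ℂ) * Complex.I * (α : ℂ)))) :
    ∀ a ∈ Aμ, Tendsto (fun n => SAdic.distInt (α * (τ.height n a : ℝ))) atTop (𝓝 0) := by
  intro a ha
  obtain ⟨f, hf2, hf0, hf⟩ := heig
  set z := Complex.exp (2 * (Real.pi : ℂ) * Complex.I * (α : ℂ)) with hz
  have hz1 : ‖z‖ = 1 := by
    have h : 2 * (Real.pi : ℂ) * Complex.I * (α : ℂ) =
        ((2 * Real.pi * α : ℝ) : ℂ) * Complex.I := by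
      push_cast
      ring
    rw [hz, h, Complex.norm_exp_ofReal_mul_I]
  obtain ⟨r, hr0, hr⟩ :=
    SAdic.norm_eq_const_of_eigenfunction hμ hz1 hf2.aestronglyMeasurable hf0 hf
  have hlim := SAdic.DirectiveSequence.tendsto_norm_pow_height_sub_one hprim hrec hμ hclean
    hratio hword hr0 hr hf (hf2.integrable one_le_two) ha
  refine squeeze_zero (fun n => SAdic.distInt_nonneg _) (fun n => ?_) hlim
  have h₁ := SAdic.four_mul_distInt_le (α * (τ.height n a : ℝ))
  have h₂ : Complex.exp (2 * (Real.pi : ℂ) * Complex.I * ((α * (τ.height n a : ℝ) : ℝ) : ℂ)) =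
      z ^ τ.height n a := by
    rw [hz, ← Complex.exp_nat_mul]
    congr 1
    push_cast
    ring
  rw [h₂] at h₁
  linarith [SAdic.distInt_nonneg (α * (τ.height n a : ℝ))]
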